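/- Theorem 1. Let $K,N\ge 2$ and $U=(K-1)N$. In the $(K,N)$ D2D private caching system with a trusted server there are $N$ independent files $F_1,\dots,F_N$ of $B$ i.i.d. uniform bits each and $K$ users. The cache of user $k$ is $Z_k=(\mathscr M(C_k),C_k)$, where the placement metadata $(\mathscr M(C_1),\dots,\mathscr M(C_K))$ is random and independent of the files and of the demands, and the content $C_k$ is a function of $\mathscr M(C_k)$ and the files; the placement is uncoded if, given $\mathscr M(C_k)$, $C_k$ consists of bits copied directly from the files. For a demand vector $\mathbf D=(D_1,\dots,D_K)\in[N]^K$ independent of the files, the trusted server, which does not access the files, draws metadata $\mathscr M(P_1),\dots,\mathscr M(P_K)$ depending on $\mathbf D$ and the placement metadata; user $k$ then broadcasts $X_k=(\mathscr M(P_k),P_k)$, where the payload $P_k$ is a function of $\mathscr M(P_k)$ and $Z_k$. Write $\mathbf X=(X_1,\dots,X_K)$. For a cache size $M\in[N/K,N]$, a load $R$ is achievable under uncoded placement and user collusion if there are $\epsilon_B\ge 0$ with $\lim_{B\to\infty}\epsilon_B=0$ such that for every sufficiently large $B$ there is a scheme with uncoded placement which, for every distribution of $\mathbf D$, satisfies,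 for all $k\in[K]$, $H(\mathscr M(C_k))\le B\epsilon_B$, $H(\mathscr M(P_k))\le B\epsilon_B$, $H(Z_k)\le B(M+\epsilon_B)$ and $H(F_{D_k}\mid \mathbf X,Z_k,D_k)\le B\epsilon_B$, and, moreover, $\sum_{k\in[K]}H(X_k)\le B(R+\epsilon_B)$ and $$I\big(\mathbf D;\mathbf X,(Z_k)_{k\in\mathcal S}\,\big|\,(D_k)_{k\in\mathcal S}\big)=0\qquad\text{for all }\emptyset\ne\mathcal S\subseteq[K].$$ Let $R^\star_{\mathrm{u,c}}(M)$ be the infimum of the achievable loads. Then, for every $M\in[N/K,N]$, $R^\star_{\mathrm{u,c}}(M)$ is at most the value at $M$ of the lower convex envelope of the points $$\left(\frac{N+t-1}{K},\ \frac{\binom{U}{t}-\binom{U-N}{t}}{\binom{U}{t-1}}\right),\qquad t\in\{1,\dots,U+1\},$$ where $\binom{x}{y}=0$ if $x<y$. -/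

import Mathlib

open scoped Topology

noncomputable section

namespace D2DCaching

/-! ### Shannon quantities, in bits, of random variables on a finite probability space -/

section Entropy

variable {Ω α β γ : Type*} [Fintype Ω]

open Classical in
/-- Shannon entropy `H(X)` in bits; the sum runs over the range of `X`. -/
def entropy (p : PMF Ω) (X : Ω → α) : ℝ :=
  ∑ x ∈ Finset.univ.image X, Real.negMulLog ((p.map X x).toReal) / Real.log 2

/-- Conditional entropy `H(X | Y) = H(X, Y) - H(Y)`. -/
def condEntropy (p : PMF Ω) (X : Ω → α) (Y : Ω → β) : ℝ :=
  entropy p (fun ω => (X ω, Y ω)) - entropy p Y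

/-- Conditional mutual information `I(X; Y | Z) = H(X | Z) - H(X | Y, Z)`. -/
def condMutualInfo (p : PMF Ω) (X : Ω → α) (Y : Ω → β) (Z : Ω → γ) : ℝ :=
  condEntropy p X Z - condEntropy p X (fun ω => (Y ω, Z ω))

end Entropy

/-! ### The D2D caching system with a trusted server -/

/-- A library of `N` files of `B` bits each. -/
abbrev Library (N B : ℕ) : Type := Fin N → Fin B → Bool

/-- A demand vector of `K` users. -/
abbrev Demands (K N : ℕ) : Type := Fin K → Fin N

/-- A caching scheme with `K` users, `N` files and `B` bits per file.
The placement metadata is drawn without looking at the library or at the demands. The trusted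
server knows the demands and the placement metadata of all users, but not the library, and draws
the metadata of the transmissions. The payload of user `k` is computed from the metadata of its
transmission and from its own cache (placement metadata and cached content) alone. -/
structure Scheme (K N B : ℕ) where
  /-- the set of possible metadata of the cache of each user -/
  CacheMeta : Fin K → Type
  /-- the set of possible metadata of the transmission of each user -/
  SendMeta : Fin K → Type
  cacheMetaFintype : ∀ k, Fintype (CacheMeta k)
  sendMetaFintype : ∀ k, Fintype (SendMeta k)
  /-- joint law of the placement metadata of all users -/
  placement : PMF (∀ k, CacheMeta k)
  /-- cached content, as a function of the metadata and of the library -/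
  content : ∀ k, CacheMeta k → Library N B → List Bool
  /-- joint law of the transmission metadata chosen by the trusted server -/
  query : Demands K N → (∀ k, CacheMeta k) → PMF (∀ k, SendMeta k)
  /-- broadcast payload, as a function of the transmission metadata and of the user's cache -/
  payload : ∀ k, SendMeta k → CacheMeta k × List Bool → List Bool

namespace Scheme

variable {K N B : ℕ} (𝒮 : Scheme K N B)

instance (k : Fin K) : Fintype (𝒮.CacheMeta k) := 𝒮.cacheMetaFintype k

instance (k : Fin K) : Fintype (𝒮.SendMeta k) := 𝒮.sendMetaFintype k

/-- Sample space: library, demands, placement metadata, transmission metadata. -/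
abbrev Outcome : Type :=
  Library N B × Demands K N × (∀ k, 𝒮.CacheMeta k) × (∀ k, 𝒮.SendMeta k)

/-- Joint law when the demand vector has law `q`: the library consists of i.i.d. uniform bits;
library, demands and placement metadata are independent; the transmission metadata is drawn given
the demands and the placement metadata. -/
def law (q : PMF (Demands K N)) : PMF 𝒮.Outcome :=
  (PMF.uniformOfFintype (Library N B)).bind fun F =>
    q.bind fun d =>
      𝒮.placement.bind fun c =>
        (𝒮.query d c).map fun m => (F, d, c, m)

/-- The demand vector `D`. -/
def demands (ω : 𝒮.Outcome) : Demands K N := ω.2.1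

/-- The file demanded by user `k`. -/
def demandedFile (k : Fin K) (ω : 𝒮.Outcome) : Fin B → Bool := ω.1 (ω.2.1 k)

/-- The metadata of the cache of user `k`. -/
def cacheMeta (k : Fin K) (ω : 𝒮.Outcome) : 𝒮.CacheMeta k := ω.2.2.1 k

/-- The metadata of the transmission of user `k`. -/
def sendMeta (k : Fin K) (ω : 𝒮.Outcome) : 𝒮.SendMeta k := ω.2.2.2 k

/-- The cache `Z_k` of user `k`: placement metadata and cached content. -/
def cache (k : Fin K) (ω : 𝒮.Outcome) : 𝒮.CacheMeta k × List Bool :=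
  (𝒮.cacheMeta k ω, 𝒮.content k (𝒮.cacheMeta k ω) ω.1)

/-- The signal `X_k` broadcast by user `k`: transmission metadata and payload. -/
def signal (k : Fin K) (ω : 𝒮.Outcome) : 𝒮.SendMeta k × List Bool :=
  (𝒮.sendMeta k ω, 𝒮.payload k (𝒮.sendMeta k ω) (𝒮.cache k ω))

/-- The vector `X` of all broadcast signals. -/
def signals (ω : 𝒮.Outcome) : ∀ k, 𝒮.SendMeta k × List Bool := fun k => 𝒮.signal k ω

/-- Uncoded placement: given its metadata, the cached content of each user is a list of bits
copied directly from the files. -/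
def IsUncoded : Prop :=
  ∀ (k : Fin K) (c : 𝒮.CacheMeta k), ∃ pos : List (Fin N × Fin B),
    ∀ F : Library N B, 𝒮.content k c F = pos.map fun ib => F ib.1 ib.2

/-- The constraints on a scheme when the demands have law `q`, for cache size `M`, load `R` and
slack `ε`, with privacy against colluding users. -/
structure Meets (q : PMF (Demands K N)) (M R ε : ℝ) : Prop where
  /-- the placement metadata is negligible with respect to the file size -/
  cacheMeta_le : ∀ k, entropy (𝒮.law q) (𝒮.cacheMeta k) ≤ B * ε
  /-- the transmission metadata is negligible with respect to the file size -/
  sendMeta_le : ∀ k, entropy (𝒮.law q) (𝒮.sendMeta k) ≤ B * ε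
  /-- cache size: `H(Z_k) ≤ B (M + ε)` -/
  cache_le : ∀ k, entropy (𝒮.law q) (𝒮.cache k) ≤ B * (M + ε)
  /-- decoding: `H(F_{D_k} | X, Z_k, D_k) ≤ B ε` -/
  decoding : ∀ k, condEntropy (𝒮.law q) (𝒮.demandedFile k)
    (fun ω => (𝒮.signals ω, 𝒮.cache k ω, 𝒮.demands ω k)) ≤ B * ε
  /-- privacy: `I(D; X, (Z_k)_{k ∈ T} | (D_k)_{k ∈ T}) = 0` for all nonempty sets `T` of users -/
  privacy : ∀ T : Finset (Fin K), T.Nonempty →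
    condMutualInfo (𝒮.law q) 𝒮.demands
      (fun ω => (𝒮.signals ω, fun k : T => 𝒮.cache k.1 ω))
      (fun ω => fun k : T => 𝒮.demands ω k.1) = 0
  /-- load: `∑ k, H(X_k) ≤ B (R + ε)` -/
  load_le : ∑ k, entropy (𝒮.law q) (𝒮.signal k) ≤ B * (R + ε)

end Scheme

/-- The load `R` is achievable with cache size `M` under uncoded placement and privacy against
colluding users: for some `ε_B → 0`, for all large file sizes `B` there is an uncoded scheme that
meets the constraints with slack `ε_B`, whatever the law of the demands is. -/
def Achievable (K N : ℕ) (M R : ℝ) : Prop :=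
  ∃ ε : ℕ → ℝ, (∀ B, 0 ≤ ε B) ∧ Filter.Tendsto ε Filter.atTop (𝓝 0) ∧
    ∀ᶠ B : ℕ in Filter.atTop, ∃ 𝒮 : Scheme K N B, 𝒮.IsUncoded ∧
      ∀ q : PMF (Demands K N), 𝒮.Meets q M R (ε B)

/-- The optimal load `R*_{u,c}(M)`: the infimum of the achievable loads (`⊤` if there are none). -/
def optimalLoad (K N : ℕ) (M : ℝ) : EReal :=
  sInf ((fun R : ℝ => (R : EReal)) '' {R : ℝ | Achievable K N M R})

/-- The lower convex envelope of a set of points of the plane at abscissa `x`: the lower boundary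
of the convex hull (`⊤` if no point of the hull has abscissa `x`). -/
def lowerConvexEnvelope (P : Set (ℝ × ℝ)) (x : ℝ) : EReal :=
  sInf ((fun r : ℝ => (r : EReal)) '' {r : ℝ | (x, r) ∈ convexHull ℝ P})

/-- The points `((N + t - 1) / K, (C(U, t) - C(U - N, t)) / C(U, t - 1))` for `1 ≤ t ≤ U + 1`,
where `U = (K - 1) N`. -/
def schemeAPoints (K N : ℕ) : Set (ℝ × ℝ) :=
  let U : ℕ := (K - 1) * N
  {P | ∃ t : ℕ, 1 ≤ t ∧ t ≤ U + 1 ∧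
    P = (((N : ℝ) + t - 1) / K,
      ((U.choose t : ℝ) - ((U - N).choose t : ℝ)) / (U.choose (t - 1) : ℝ))}

end D2DCaching

end

/-! Each user `k` draws a private uniform shift `r k`, and the server announces only `m = d - r`.
This is a one-time pad: `m` is uniform and independent of the demands and files. User `k` acts as
the server of a virtual caching system with `U = (K - 1) * N` slots `(j, x)`, `j ≠ k`, where slot
`(j, x)` demands file `x + m j`. User `j` occupies slot `(j, r j)`, whose demand is `d j`. The
messages depend on `m` and the files only, so a coalition learns nothing beyond its own demands
(`condMutualInfo_prodLaw_eq_zero`, `meets_toScheme`).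

Delivery XORs, over the slots of a set `S`, the part each slot wants and all others in `S` cache.
Whatever `m` is, the `N` slots of one user demand every file exactly once, so they serve as leaders.
The linear relation `sum_multicast_sdiff_transversal` makes the messages of sets without a leader
redundant (`multicast_eq_of_leaders`), leaving `C(U, t) - C(U - N, t)` messages per user. With `s =
t - 1`, counting gives cache size `(N + s) / K` (`card_cached`) and the stated load (`card_index`);
splitting the files between several `s` gives the convex hull. -/

noncomputable section

namespace D2DCaching

/-! ### Entropy of functions on a finite probability space -/

section Entropy

variable {Ω Ω' α β γ : Type*} [Fintype Ω] [Fintype Ω']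

lemma sum_toReal_eq_one (p : PMF Ω) : ∑ ω, (p ω).toReal = 1 := by
  rw [← ENNReal.toReal_sum fun ω _ => p.apply_ne_top ω, ← tsum_fintype (L := .unconditional _),
    p.tsum_coe, ENNReal.toReal_one]

open Classical in
lemma toReal_map_apply (p : PMF Ω) (X : Ω → α) (x : α) :
    (p.map X x).toReal = ∑ ω, if x = X ω then (p ω).toReal else 0 := by
  rw [PMF.map_apply, tsum_fintype, ENNReal.toReal_sum]
  · exact Finset.sum_congr rfl fun ω _ => by split_ifs <;> simp
  · intro ω _
    split_ifs
    · exact p.apply_ne_top ω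
    · simp

lemma map_apply_eq_zero (p : PMF β) (X : β → α) {x : α} (hx : ∀ ω, X ω ≠ x) : p.map X x = 0 := by
  rw [PMF.apply_eq_zero_iff, PMF.mem_support_map_iff]
  rintro ⟨ω, -, rfl⟩
  exact hx ω rfl

lemma entropy_eq_sum (p : PMF Ω) (X : Ω → α) {s : Finset α} (hs : ∀ ω, X ω ∈ s) :
    entropy p X = ∑ x ∈ s, Real.negMulLog ((p.map X x).toReal) / Real.log 2 := by
  classical
  unfold entropy
  refine Finset.sum_subset_zero_on_sdiff ?_ ?_ ?_
  · intro x hx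
    obtain ⟨ω, -, rfl⟩ := Finset.mem_image.1 hx
    exact hs ω
  · intro x hx
    rw [map_apply_eq_zero p X]
    · simp
    · rintro ω rfl
      simp at hx
  · intro x _
    congr!

lemma sum_toReal_map (p : PMF Ω) (X : Ω → α) {s : Finset α} (hs : ∀ ω, X ω ∈ s) :
    ∑ x ∈ s, (p.map X x).toReal = 1 := by
  classical
  simp_rw [toReal_map_apply]
  rw [Finset.sum_comm, ← sum_toReal_eq_one p]
  refine Finset.sum_congr rfl fun ω _ => ?_
  rw [Finset.sum_ite_eq' s (X ω), if_pos (hs ω)]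

/-- In this form `X` enters only through the events `X ω = X ω'`, which is what `entropy_congr`
exploits. -/
lemma entropy_eq_sum_outcomes (p : PMF Ω) (X : Ω → α) :
    entropy p X =
      ∑ ω, -((p ω).toReal * Real.log ((p.map X (X ω)).toReal)) / Real.log 2 := by
  classical
  rw [entropy_eq_sum p X (s := Finset.univ.image X) (by simp)]
  rw [← Finset.sum_fiberwise_of_maps_to (s := Finset.univ) (t := Finset.univ.image X) (g := X)
    (by simp)]
  refine Finset.sum_congr rfl fun x _ => ?_
  rw [← Finset.sum_div]
  congr 1
  have h : ∀ ω ∈ Finset.univ.filter (X · = x),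
      -((p ω).toReal * Real.log ((p.map X (X ω)).toReal)) =
        (p ω).toReal * -Real.log ((p.map X x).toReal) := by
    intro ω hω
    rw [(Finset.mem_filter.1 hω).2]
    ring
  rw [Finset.sum_congr rfl h, ← Finset.sum_mul, Finset.sum_filter, Real.negMulLog]
  have : ∑ ω, (if X ω = x then (p ω).toReal else 0) = (p.map X x).toReal := by
    rw [toReal_map_apply]
    simp_rw [eq_comm]
  rw [this]
  ring

/-- Entropy depends only on the partition of the sample space. -/
lemma entropy_congr (p : PMF Ω) {X : Ω → α} {Y : Ω → β}
    (h : ∀ ω ω', X ω = X ω' ↔ Y ω = Y ω') : entropy p X = entropy p Y := by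
  classical
  rw [entropy_eq_sum_outcomes, entropy_eq_sum_outcomes]
  simp_rw [toReal_map_apply, h]

lemma entropy_map (p : PMF Ω) (g : Ω → Ω') (X : Ω' → α) :
    entropy (p.map g) X = entropy p (X ∘ g) := by
  classical
  rw [entropy_eq_sum (p.map g) X (s := Finset.univ.image X) (by simp),
    entropy_eq_sum p (X ∘ g) (s := Finset.univ.image X) (by simp), PMF.map_comp]

lemma condEntropy_map (p : PMF Ω) (g : Ω → Ω') (X : Ω' → α) (Y : Ω' → β) :
    condEntropy (p.map g) X Y = condEntropy p (X ∘ g) (Y ∘ g) := by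
  unfold condEntropy
  rw [entropy_map, entropy_map]
  rfl

lemma condMutualInfo_map (p : PMF Ω) (g : Ω → Ω') (X : Ω' → α) (Y : Ω' → β) (Z : Ω' → γ) :
    condMutualInfo (p.map g) X Y Z = condMutualInfo p (X ∘ g) (Y ∘ g) (Z ∘ g) := by
  unfold condMutualInfo
  rw [condEntropy_map, condEntropy_map]
  rfl

lemma condEntropy_eq_zero (p : PMF Ω) {X : Ω → α} {Y : Ω → β}
    (h : ∀ ω ω', Y ω = Y ω' → X ω = X ω') : condEntropy p X Y = 0 := by
  rw [condEntropy, sub_eq_zero]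
  refine entropy_congr p fun ω ω' => ?_
  simp only [Prod.mk.injEq]
  exact ⟨fun h => h.2, fun h' => ⟨h _ _ h', h'⟩⟩

/-- The uniform bound on the entropy. -/
lemma entropy_le_logb_card (p : PMF Ω) (X : Ω → α) {s : Finset α} (hs : ∀ ω, X ω ∈ s) :
    entropy p X ≤ Real.logb 2 s.card := by
  have h1 := sum_toReal_map p X hs
  have hn : (0 : ℝ) < s.card := by
    rcases s.eq_empty_or_nonempty with rfl | h
    · simp at h1
    · exact_mod_cast h.card_pos
  rw [entropy_eq_sum p X hs, ← Finset.sum_div, Real.logb]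
  refine div_le_div_of_nonneg_right ?_ (Real.log_nonneg (by norm_num))
  have key : ∀ x ∈ s, Real.negMulLog ((p.map X x).toReal) ≤
      (p.map X x).toReal * Real.log s.card + (1 / s.card - (p.map X x).toReal) := by
    intro x _
    set r := (p.map X x).toReal
    have hr : 0 ≤ r := ENNReal.toReal_nonneg
    rcases hr.eq_or_lt with h0 | h0
    · rw [← h0]
      simp
    -- Gibbs' inequality against the uniform law on `s`, term by term.
    · have := Real.log_le_sub_one_of_pos (x := 1 / (s.card * r)) (by positivity)
      rw [one_div, Real.log_inv, Real.log_mul hn.ne' h0.ne'] at this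
      have h2 := mul_le_mul_of_nonneg_left this hr
      rw [Real.negMulLog]
      have h3 : r * ((s.card * r)⁻¹ - 1) = 1 / s.card - r := by field_simp
      rw [h3] at h2
      linarith
  refine (Finset.sum_le_sum key).trans ?_
  rw [Finset.sum_add_distrib, ← Finset.sum_mul, Finset.sum_sub_distrib, h1]
  simp [hn.ne']

/-- The law of a pair of independent random variables. -/
def prodLaw (q : PMF α) (μ : PMF β) : PMF (α × β) :=
  q.bind fun x => μ.map (Prod.mk x)

lemma prodLaw_apply (q : PMF α) (μ : PMF β) (x : α) (w : β) :
    prodLaw q μ (x, w) = q x * μ w := by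
  classical
  rw [prodLaw, PMF.bind_apply, tsum_eq_single x]
  · rw [PMF.map_apply, tsum_eq_single w]
    · simp
    · intro w' hw
      simp [hw.symm]
  · intro x' hx
    rw [PMF.map_apply]
    simp [hx.symm]

lemma map_prodLaw_fst (q : PMF α) (μ : PMF β) : (prodLaw q μ).map Prod.fst = q := by
  rw [prodLaw, PMF.map_bind]
  simp_rw [PMF.map_comp]
  exact (congrArg q.bind (funext fun x => μ.map_const x)).trans q.bind_pure

lemma map_prodLaw (q : PMF α) (μ : PMF β) (a : α → γ) :
    (prodLaw q μ).map (Prod.map a id) = prodLaw (q.map a) μ := by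
  rw [prodLaw, prodLaw, PMF.map_bind, PMF.bind_map]
  simp_rw [PMF.map_comp]
  rfl

/-- Chain rule for a function of two independent random variables. -/
lemma entropy_prodLaw (q : PMF Ω) (μ : PMF Ω') (f : Ω → Ω' → γ) :
    entropy (prodLaw q μ) (fun ω => (ω.1, f ω.1 ω.2)) =
      entropy q id + ∑ x, (q x).toReal * entropy μ (f x) := by
  classical
  set T : Finset γ := Finset.univ.image fun ω : Ω × Ω' => f ω.1 ω.2
  have hT : ∀ x w, f x w ∈ T := fun x w => Finset.mem_image.2 ⟨(x, w), Finset.mem_univ _, rfl⟩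
  have hm : ∀ x g, ((prodLaw q μ).map (fun ω => (ω.1, f ω.1 ω.2)) (x, g)).toReal =
      (q x).toReal * (μ.map (f x) g).toReal := by
    intro x g
    rw [toReal_map_apply, toReal_map_apply, Fintype.sum_prod_type, Finset.sum_eq_single x]
    · rw [Finset.mul_sum]
      refine Finset.sum_congr rfl fun w _ => ?_
      rw [prodLaw_apply, ENNReal.toReal_mul]
      simp
    · intro x' _ hx
      refine Finset.sum_eq_zero fun w _ => ?_
      rw [if_neg]
      simp [hx.symm]
    · simp
  rw [entropy_eq_sum _ _ (s := Finset.univ ×ˢ T)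
    (fun ω => Finset.mem_product.2 ⟨Finset.mem_univ _, hT _ _⟩), Finset.sum_product,
    entropy_eq_sum q id (s := Finset.univ) (by simp), ← Finset.sum_add_distrib]
  refine Finset.sum_congr rfl fun x _ => ?_
  rw [entropy_eq_sum μ (f x) (hT x), Finset.mul_sum]
  simp_rw [hm, Real.negMulLog_mul, add_div, mul_div_assoc]
  rw [Finset.sum_add_distrib, ← Finset.sum_mul, sum_toReal_map μ (f x) (hT x), PMF.map_id, one_mul]

/-- A random variable computed from `a(D)` and from noise independent of `D` reveals nothing
about `D` beyond `a(D)`. -/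
lemma condMutualInfo_prodLaw_eq_zero [Fintype α] (q : PMF Ω) (μ : PMF Ω') (a : Ω → α)
    {Y : Ω × Ω' → γ} (f : α → Ω' → γ) (hY : ∀ ω, Y ω = f (a ω.1) ω.2) :
    condMutualInfo (prodLaw q μ) Prod.fst Y (fun ω => a ω.1) = 0 := by
  classical
  have h1 : entropy (prodLaw q μ) (fun ω => (ω.1, a ω.1)) = entropy q id := by
    rw [entropy_congr (prodLaw q μ) (Y := id ∘ Prod.fst) (by simp +contextual),
      ← entropy_map, map_prodLaw_fst]
  have h2 : entropy (prodLaw q μ) (fun ω => a ω.1) = entropy (q.map a) id := by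
    rw [show (fun ω : Ω × Ω' => a ω.1) = id ∘ Prod.fst ∘ Prod.map a id from rfl,
      ← Function.comp_assoc, ← entropy_map, map_prodLaw, ← entropy_map, map_prodLaw_fst]
  have h3 : entropy (prodLaw q μ) (fun ω => (ω.1, Y ω, a ω.1)) =
      entropy q id + ∑ x, (q x).toReal * entropy μ (f (a x)) := by
    rw [← entropy_prodLaw q μ (fun x => f (a x))]
    refine entropy_congr _ fun ω ω' => ?_
    simp only [hY, Prod.mk.injEq]
    exact ⟨fun h => ⟨h.1, h.2.1⟩, fun h => ⟨h.1, h.2, by rw [h.1]⟩⟩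
  have h4 : entropy (prodLaw q μ) (fun ω => (Y ω, a ω.1)) =
      entropy (q.map a) id + ∑ y, (q.map a y).toReal * entropy μ (f y) := by
    rw [← entropy_prodLaw (q.map a) μ f, ← map_prodLaw, entropy_map]
    refine entropy_congr _ fun ω ω' => ?_
    simp only [hY, Prod.mk.injEq, Function.comp, Prod.map_fst, Prod.map_snd, id]
    exact and_comm
  -- The noise adds the same average entropy whether one conditions on all of `D` or only on `a(D)`,
  -- so these terms cancel.
  have h5 : ∑ y, (q.map a y).toReal * entropy μ (f y) =
      ∑ x, (q x).toReal * entropy μ (f (a x)) := by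
    simp_rw [toReal_map_apply, Finset.sum_mul, ite_mul, zero_mul]
    rw [Finset.sum_comm]
    refine Finset.sum_congr rfl fun x _ => ?_
    simp
  unfold condMutualInfo condEntropy
  rw [h1, h2, h3, h4, h5]
  ring

end Entropy

/-- The entropy of a finite label together with a list of bits whose length is a function of the
label. -/
lemma entropy_le_of_length {Ω α : Type*} [Fintype Ω] [Fintype α] (p : PMF Ω) (m : Ω → α)
    (l : Ω → List Bool) (len : α → ℕ) (hl : ∀ ω, (l ω).length = len (m ω)) {n : ℕ}
    (hn : ∀ a, len a ≤ n) :
    entropy p (fun ω => (m ω, l ω)) ≤ Real.logb 2 (Fintype.card α) + n := by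
  classical
  set s : Finset (α × List Bool) := Finset.univ.biUnion fun a =>
    Finset.univ.image fun v : List.Vector Bool (len a) => (a, v.toList)
  have hs : ∀ ω, (m ω, l ω) ∈ s := fun ω =>
    Finset.mem_biUnion.2 ⟨m ω, Finset.mem_univ _,
      Finset.mem_image.2 ⟨⟨l ω, hl ω⟩, Finset.mem_univ _, rfl⟩⟩
  obtain ⟨ω, -⟩ := p.support_nonempty
  have hpos : 0 < s.card := Finset.card_pos.2 ⟨_, hs ω⟩
  have hcard : s.card ≤ Fintype.card α * 2 ^ n := by
    refine Finset.card_biUnion_le_card_mul _ _ _ fun a _ => Finset.card_image_le.trans ?_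
    rw [Finset.card_univ, card_vector, Fintype.card_bool]
    exact Nat.pow_le_pow_right (by norm_num) (hn a)
  have hα : (0 : ℝ) < Fintype.card α := by exact_mod_cast Fintype.card_pos_iff.2 ⟨m ω⟩
  calc entropy p (fun ω => (m ω, l ω)) ≤ Real.logb 2 s.card := entropy_le_logb_card p _ hs
    _ ≤ Real.logb 2 (Fintype.card α * 2 ^ n) :=
      Real.logb_le_logb_of_le (by norm_num) (by exact_mod_cast hpos) (by exact_mod_cast hcard)
    _ = Real.logb 2 (Fintype.card α) + n := by
      rw [Real.logb_mul hα.ne' (by positivity), Real.logb_pow, Real.logb_self_eq_one (by norm_num),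
        mul_one]

/-! ### Private schemes from shift codes -/

lemma map_uniformOfFintype {α : Type*} [Fintype α] [Nonempty α] (e : α ≃ α) :
    (PMF.uniformOfFintype α).map e = PMF.uniformOfFintype α := by
  classical
  ext b
  rw [PMF.map_apply, tsum_eq_single (e.symm b)]
  · simp
  · intro a ha
    rw [if_neg]
    rintro rfl
    simp at ha

/-- A code whose caches depend on a shift `r` of each user, and whose messages depend on the
differences `m` between the demands and the shifts. -/
structure ShiftCode (K N B : ℕ) where
  /-- the positions of the bits of the message of each user -/
  Index : Fin K → Type
  indexFintype : ∀ k, Fintype (Index k)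
  /-- the bits cached by each user, as a function of the shift of the user -/
  cached : Fin K → Fin N → Finset (Fin N × Fin B)
  /-- the message of each user -/
  message : ∀ k, Demands K N → Library N B → Index k → Bool

namespace ShiftCode

variable {K N B : ℕ} (C : ShiftCode K N B)

instance (k : Fin K) : Fintype (C.Index k) := C.indexFintype k

/-- The libraries `F` and `F'` have the same bits at the positions of `P`. -/
def AgreeOn (P : Finset (Fin N × Fin B)) (F F' : Library N B) : Prop :=
  ∀ ib ∈ P, F ib.1 ib.2 = F' ib.1 ib.2

/-- The list of cached bits. -/
def cacheList (k : Fin K) (r : Fin N) (F : Library N B) : List Bool :=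
  (C.cached k r).toList.map fun ib => F ib.1 ib.2

/-- The list of the bits of the message. -/
def messageList (k : Fin K) (m : Demands K N) (F : Library N B) : List Bool :=
  (Finset.univ : Finset (C.Index k)).toList.map (C.message k m F)

lemma cacheList_eq_iff {k : Fin K} {r : Fin N} {F F' : Library N B} :
    C.cacheList k r F = C.cacheList k r F' ↔ AgreeOn (C.cached k r) F F' := by
  simp [cacheList, AgreeOn, List.map_inj_left]

lemma messageList_eq_iff {k : Fin K} {m : Demands K N} {F F' : Library N B} :
    C.messageList k m F = C.messageList k m F' ↔ C.message k m F = C.message k m F' := by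
  simp [messageList, List.map_inj_left, funext_iff]

variable [NeZero N]

/-- The scheme of a shift code: independent uniform shifts are the placement metadata, and the
differences between the demands and the shifts are the transmission metadata. -/
def toScheme : Scheme K N B where
  CacheMeta _ := Fin N
  SendMeta _ := Demands K N
  cacheMetaFintype _ := inferInstance
  sendMetaFintype _ := inferInstance
  placement := PMF.uniformOfFintype (Fin K → Fin N)
  content := C.cacheList
  query d r := PMF.pure fun _ => d - r
  payload k m z := C.messageList k m (Function.invFun (C.cacheList k z.1) z.2)

lemma isUncoded_toScheme : C.toScheme.IsUncoded :=
  fun k r => ⟨(C.cached k r).toList, fun _ => rfl⟩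

/-- The outcome determined by the demands, the library and the transmission metadata. -/
def outcome (ω : Demands K N × (Library N B × Demands K N)) : C.toScheme.Outcome :=
  (ω.2.1, ω.1, ω.1 - ω.2.2, fun _ => ω.2.2)

lemma outcome_sub (F : Library N B) (d r : Demands K N) :
    ((F, d, r, fun _ => d - r) : C.toScheme.Outcome) = C.outcome (d, (F, d - r)) := by
  have h : d - (d - r) = r := sub_sub_cancel d r
  refine Prod.ext rfl (Prod.ext rfl (Prod.ext ?_ rfl))
  exact h.symm

/-- The transmission metadata are a one-time pad of the demands. -/
lemma law_toScheme (q : PMF (Demands K N)) :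
    C.toScheme.law q =
      (prodLaw q (prodLaw (PMF.uniformOfFintype (Library N B))
        (PMF.uniformOfFintype (Demands K N)))).map C.outcome := by
  rw [Scheme.law, PMF.bind_comm, prodLaw, PMF.map_bind]
  congr 1
  funext d
  rw [prodLaw, PMF.map_bind, PMF.map_bind]
  congr 1
  funext F
  rw [PMF.map_comp, PMF.map_comp]
  -- For fixed `d` the map `r ↦ d - r` is a bijection, so a uniform shift may be traded for a
  -- uniform `m`.
  conv_rhs => rw [← map_uniformOfFintype (Equiv.subLeft d), PMF.map_comp]
  rw [← PMF.bind_pure_comp]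
  change (PMF.uniformOfFintype (Fin K → Fin N)).bind _ = _
  congr 1
  funext r
  refine (PMF.pure_map _ _).trans (congrArg PMF.pure ?_)
  exact outcome_sub C F d r

/-- Every user can compute its message from its cache. -/
def IsLocal : Prop :=
  ∀ k r m F F', AgreeOn (C.cached k r) F F' → C.message k m F = C.message k m F'

/-- Every user can decode the file `r + m k` from its cache and from all messages. -/
def IsDecodable : Prop :=
  ∀ k r m F F', AgreeOn (C.cached k r) F F' → (∀ j, C.message j m F = C.message j m F') →
    F (r + m k) = F' (r + m k)

variable {C}

/-- The payload is computed from some library consistent with the cache; locality makes it the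
message of the true library. -/
lemma signal_outcome (hC : C.IsLocal) (k : Fin K)
    (ω : Demands K N × (Library N B × Demands K N)) :
    C.toScheme.signal k (C.outcome ω) = (ω.2.2, C.messageList k ω.2.2 ω.2.1) := by
  refine Prod.ext rfl ?_
  change C.messageList k ω.2.2 (Function.invFun (C.cacheList k (ω.1 k - ω.2.2 k))
    (C.cacheList k (ω.1 k - ω.2.2 k) ω.2.1)) = _
  rw [messageList_eq_iff]
  refine hC k (ω.1 k - ω.2.2 k) _ _ _ ?_
  rw [← cacheList_eq_iff]
  exact Function.invFun_eq ⟨_, rfl⟩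

/-- In the slack, `c` absorbs excess cached bits, one `logb 2 N` pays for a shift, and `K * K` of
them pay for `m` being repeated in all `K` signals. -/
lemma meets_toScheme (hloc : C.IsLocal) (hdec : C.IsDecodable) {M R c ε : ℝ} (hc : 0 ≤ c)
    (hcache : ∀ k r, ((C.cached k r).card : ℝ) ≤ B * M + c)
    (hload : ∑ k, (Fintype.card (C.Index k) : ℝ) ≤ B * R)
    (hε : c + (K * K + 1) * Real.logb 2 N ≤ B * ε) (q : PMF (Demands K N)) :
    C.toScheme.Meets q M R ε := by
  have hN : (1 : ℝ) ≤ N := by exact_mod_cast NeZero.one_le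
  have hlog : 0 ≤ Real.logb 2 N := Real.logb_nonneg (by norm_num) hN
  have hmeta : Real.logb 2 (Fintype.card (Demands K N)) = K * Real.logb 2 N := by
    rw [Fintype.card_fun, Fintype.card_fin, Fintype.card_fin, Nat.cast_pow, Real.logb_pow]
  have hKK : (K : ℝ) ≤ K * K + 1 := by nlinarith [sq_nonneg ((K : ℝ) - 1)]
  rw [add_mul, one_mul] at hε
  have hKlog : (K : ℝ) * Real.logb 2 N ≤ K * K * Real.logb 2 N + Real.logb 2 N := by
    nlinarith
  have hKKlog : 0 ≤ (K : ℝ) * K * Real.logb 2 N := by positivity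
  constructor
  · intro k
    rw [law_toScheme, entropy_map]
    have := entropy_le_logb_card (prodLaw q (prodLaw (PMF.uniformOfFintype (Library N B))
        (PMF.uniformOfFintype (Demands K N)))) (C.toScheme.cacheMeta k ∘ C.outcome)
        (s := Finset.univ) (by simp)
    rw [Finset.card_univ, show Fintype.card (C.toScheme.CacheMeta k) = N from Fintype.card_fin N]
      at this
    linarith
  · intro k
    rw [law_toScheme, entropy_map]
    have := entropy_le_logb_card (prodLaw q (prodLaw (PMF.uniformOfFintype (Library N B))
        (PMF.uniformOfFintype (Demands K N)))) (C.toScheme.sendMeta k ∘ C.outcome)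
        (s := Finset.univ) (by simp)
    rw [Finset.card_univ, show Fintype.card (C.toScheme.SendMeta k) = Fintype.card (Demands K N)
      from rfl, hmeta] at this
    linarith
  · intro k
    rw [law_toScheme, entropy_map]
    obtain ⟨r₀, -, hr₀⟩ := Finset.exists_max_image Finset.univ (fun r => (C.cached k r).card)
      ⟨0, Finset.mem_univ _⟩
    have := entropy_le_of_length (prodLaw q (prodLaw (PMF.uniformOfFintype (Library N B))
        (PMF.uniformOfFintype (Demands K N)))) (fun ω => ω.1 k - ω.2.2 k)
        (fun ω => C.cacheList k (ω.1 k - ω.2.2 k) ω.2.1) (fun r => (C.cached k r).card)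
        (by simp [cacheList]) (fun r => hr₀ r (Finset.mem_univ _))
    rw [Fintype.card_fin] at this
    have h2 := hcache k r₀
    refine this.trans ?_
    linarith
  · intro k
    rw [law_toScheme, condEntropy_map, condEntropy_eq_zero]
    · linarith
    intro ω ω' h
    obtain ⟨h1, h'⟩ := Prod.mk.inj h
    obtain ⟨h2, h4⟩ := Prod.mk.inj h'
    replace h1 : ∀ j, ω.2.2 = ω'.2.2 ∧
        C.messageList j ω.2.2 ω.2.1 = C.messageList j ω'.2.2 ω'.2.1 := by
      intro j
      have := congrFun h1 j
      simp only [Scheme.signals, signal_outcome hloc] at this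
      exact Prod.mk.inj this
    obtain ⟨h2, h3⟩ := Prod.mk.inj h2
    change ω.1 k - ω.2.2 k = ω'.1 k - ω'.2.2 k at h2
    change C.cacheList k (ω.1 k - ω.2.2 k) ω.2.1 = C.cacheList k (ω'.1 k - ω'.2.2 k) ω'.2.1 at h3
    have h4 : ω.1 k = ω'.1 k := h4
    have hm : ω.2.2 = ω'.2.2 := (h1 k).1
    rw [← h2, cacheList_eq_iff] at h3
    have := hdec k (ω.1 k - ω.2.2 k) ω.2.2 ω.2.1 ω'.2.1 h3 fun j => by
      have := (h1 j).2
      rw [← hm] at this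
      exact C.messageList_eq_iff.1 this
    rw [sub_add_cancel] at this
    change ω.2.1 (ω.1 k) = ω'.2.1 (ω'.1 k)
    rw [this, h4]
  · intro T _
    rw [law_toScheme, condMutualInfo_map]
    -- The noise is `w = (F, m)`; the shifts of the users in `T` are recovered as `d - m` on `T`.
    refine condMutualInfo_prodLaw_eq_zero q _ (fun d => fun k : T => d k.1)
      (fun d w => (fun k => (w.2, C.messageList k w.2 w.1),
        fun k : T => (d k - w.2 k.1, C.cacheList k.1 (d k - w.2 k.1) w.1))) ?_
    intro ω
    refine Prod.ext ?_ rfl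
    funext k
    exact signal_outcome hloc k ω
  · have hk : ∀ k, entropy (C.toScheme.law q) (C.toScheme.signal k) ≤
        K * Real.logb 2 N + Fintype.card (C.Index k) := by
      intro k
      rw [law_toScheme, entropy_map, ← hmeta]
      have := entropy_le_of_length (prodLaw q (prodLaw (PMF.uniformOfFintype (Library N B))
        (PMF.uniformOfFintype (Demands K N)))) (fun ω => ω.2.2)
        (fun ω => C.messageList k ω.2.2 ω.2.1) (fun _ => Fintype.card (C.Index k))
        (by simp [messageList]) (fun _ => le_rfl)
      rwa [show C.toScheme.signal k ∘ C.outcome = fun ω => (ω.2.2, C.messageList k ω.2.2 ω.2.1)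
        from funext (signal_outcome hloc k)]
    refine (Finset.sum_le_sum fun k _ => hk k).trans ?_
    rw [Finset.sum_add_distrib, Finset.sum_const, Finset.card_univ, Fintype.card_fin, nsmul_eq_mul]
    linarith

end ShiftCode

/-! ### Multicast messages and their redundancy -/

section Multicast

variable {V I G : Type*} [DecidableEq V] [Fintype I] [DecidableEq I] [AddCommGroup G]

/-- The multicast message of a set `S` of slots with demands `d`: the sum over the slots `v` of
`S` of the part of the file `d v` that is cached by the other slots of `S`. -/
def multicast (d : V → I) (A : I → Finset V → G) (S : Finset V) : G :=
  ∑ v ∈ S, A (d v) (S.erase v)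

/-- The sets of slots contained in `T` that demand each file exactly once, as sections of `d`. -/
def transversals (d : V → I) (T : Finset V) : Finset (I → V) :=
  Fintype.piFinset fun i => T.filter (d · = i)

omit [DecidableEq V] in
lemma mem_transversals {d : V → I} {T : Finset V} {f : I → V} :
    f ∈ transversals d T ↔ ∀ i, f i ∈ T ∧ d (f i) = i := by
  simp [transversals]

/-- The linear relation between the multicast messages: the messages of the complements of the
transversals of any set sum to zero. -/
lemma sum_multicast_sdiff_transversal (hG : ∀ x : G, x + x = 0) (d : V → I)
    (A : I → Finset V → G) (T : Finset V) :
    ∑ f ∈ transversals d T, multicast d A (T \ Finset.univ.image f) = 0 := by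
  unfold multicast
  rw [Finset.sum_sigma']
  have hmem : ∀ a : (_ : I → V) × V,
      a ∈ (transversals d T).sigma (fun f => T \ Finset.univ.image f) →
      (∀ i, a.1 i ∈ T ∧ d (a.1 i) = i) ∧ a.2 ∈ T ∧ ∀ i, a.1 i ≠ a.2 := by
    intro a ha
    simpa [mem_transversals] using ha
  have hinj : ∀ f : I → V, (∀ i, f i ∈ T ∧ d (f i) = i) → ∀ i j, f i = f j → i = j := by
    intro f hf i j h
    rw [← (hf i).2, h, (hf j).2]
  -- Terms are pairs of a transversal `f` and a slot `v` outside it. Exchanging `v` with the slot of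
  -- `f` that demands the same file yields the same part, so terms cancel in pairs in characteristic
  -- 2.
  refine Finset.sum_involution
    (fun a _ => ⟨Function.update a.1 (d a.2) a.2, a.1 (d a.2)⟩) ?_ ?_ ?_ ?_
  · rintro ⟨f, v⟩ ha
    obtain ⟨hf, hv, hne⟩ := hmem _ ha
    dsimp only at hf hv hne ⊢
    rw [(hf (d v)).2]
    rw [show (T \ Finset.univ.image (Function.update f (d v) v)).erase (f (d v)) =
      (T \ Finset.univ.image f).erase v from ?_, hG]
    ext x
    simp only [Finset.mem_erase, Finset.mem_sdiff, Finset.mem_image, Finset.mem_univ, true_and,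
      not_exists]
    constructor
    · rintro ⟨h1, h2, h3⟩
      refine ⟨?_, h2, fun i hi => ?_⟩
      · rintro rfl
        exact h3 (d x) (by simp)
      · by_cases hiv : i = d v
        · exact h1 (by rw [← hi, hiv])
        · exact h3 i (by rw [Function.update_of_ne hiv, hi])
    · rintro ⟨h1, h2, h3⟩
      refine ⟨fun h => h3 _ h.symm, h2, fun i hi => ?_⟩
      by_cases hiv : i = d v
      · subst hiv
        rw [Function.update_self] at hi
        exact h1 hi.symm
      · rw [Function.update_of_ne hiv] at hi
        exact h3 i hi
  · rintro ⟨f, v⟩ ha _ h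
    obtain ⟨hf, hv, hne⟩ := hmem _ ha
    exact hne (d v) (eq_of_heq (Sigma.mk.inj h).2)
  · rintro ⟨f, v⟩ ha
    obtain ⟨hf, hv, hne⟩ := hmem _ ha
    simp only [Finset.mem_sigma, mem_transversals, Finset.mem_sdiff, Finset.mem_image,
      Finset.mem_univ, true_and, not_exists]
    refine ⟨fun i => ?_, (hf _).1, fun i => ?_⟩
    · by_cases hiv : i = d v
      · subst hiv
        simpa using hv
      · rw [Function.update_of_ne hiv]
        exact hf i
    · by_cases hiv : i = d v
      · subst hiv
        rw [Function.update_self]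
        exact (hne _).symm
      · rw [Function.update_of_ne hiv]
        exact fun h => hiv (hinj f hf _ _ h)
  · rintro ⟨f, v⟩ ha
    obtain ⟨hf, hv, hne⟩ := hmem _ ha
    have h := (hf (d v)).2
    dsimp only at h
    simp [h]

/-- The multicast messages of the sets that contain a leader determine all of them. -/
lemma multicast_eq_of_leaders (hG : ∀ x : G, x + x = 0) {d : V → I} {u : I → V}
    (hu : ∀ i, d (u i) = i) {A A' : I → Finset V → G}
    (h : ∀ S, (∃ i, u i ∈ S) → multicast d A S = multicast d A' S) (S : Finset V) :
    multicast d A S = multicast d A' S := by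
  by_cases hS : ∃ i, u i ∈ S
  · exact h S hS
  push Not at hS
  -- In the relation for this `T`, the transversal `u` contributes the message of `S`. Any other
  -- transversal misses some leader, so its complement contains one.
  set T := S ∪ Finset.univ.image u
  have huT : u ∈ transversals d T := mem_transversals.2 fun i => ⟨by simp [T], hu i⟩
  have hTS : T \ Finset.univ.image u = S := by
    rw [Finset.union_sdiff_right, Finset.sdiff_eq_self_iff_disjoint, Finset.disjoint_right]
    simpa using hS
  have key : ∀ A : I → Finset V → G, multicast d A S =
      ∑ f ∈ (transversals d T).erase u, multicast d A (T \ Finset.univ.image f) := by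
    intro A
    have h0 := sum_multicast_sdiff_transversal hG d A T
    rw [← Finset.add_sum_erase _ _ huT, hTS] at h0
    rw [eq_neg_of_add_eq_zero_left h0, neg_eq_of_add_eq_zero_left (hG _)]
  rw [key A, key A']
  refine Finset.sum_congr rfl fun f hf => h _ ?_
  obtain ⟨hne, hf⟩ := Finset.mem_erase.1 hf
  rw [mem_transversals] at hf
  obtain ⟨i, hi⟩ := Function.ne_iff.1 hne
  refine ⟨i, ?_⟩
  simp only [Finset.mem_sdiff, Finset.mem_image, Finset.mem_univ, true_and, not_exists]
  refine ⟨by simp [T], fun j hj => hi ?_⟩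
  have : j = i := by rw [← (hf j).2, hj, hu]
  rw [← hj, this]

omit [Fintype I] [DecidableEq I] in
/-- A slot decodes the demanded file from all multicast messages and from the parts it caches. -/
lemma eq_of_multicast_eq {d : V → I} {v : V} {A A' : I → Finset V → G}
    (hcache : ∀ i W, v ∈ W → A i W = A' i W)
    (h : ∀ S, multicast d A S = multicast d A' S) (W : Finset V) : A (d v) W = A' (d v) W := by
  by_cases hv : v ∈ W
  · exact hcache _ _ hv
  -- All other terms are parts indexed by sets containing `v`, hence cached by `v`.
  have key : ∀ A : I → Finset V → G, multicast d A (insert v W) =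
      A (d v) W + ∑ w ∈ W, A (d w) ((insert v W).erase w) := by
    intro A
    rw [multicast, Finset.sum_insert hv, Finset.erase_insert hv]
  have h1 := h (insert v W)
  rw [key A, key A'] at h1
  rw [Finset.sum_congr rfl fun w hw => hcache (d w) ((insert v W).erase w) ?_] at h1
  · exact add_right_cancel h1
  · refine Finset.mem_erase.2 ⟨?_, Finset.mem_insert_self _ _⟩
    rintro rfl
    exact hv hw

end Multicast

/-! ### The multicast shift code -/

/-- The slots served by user `k`: every other user has `N` slots. -/
abbrev Slot (K N : ℕ) (k : Fin K) : Type := {j : Fin K // j ≠ k} × Fin N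

/-- The bits of a file that are cached in part: those transmitted by user `k` and cached by the
slots of `W` are `n |W|` many. -/
abbrev Part (K N : ℕ) (n : ℕ → ℕ) : Type :=
  Σ k : Fin K, Σ W : Finset (Slot K N k), Fin (n W.card)

section Code

variable {K N B L : ℕ} {n : ℕ → ℕ}

/-- A user `j` with shift `r` caches all bits that it transmits and the bits of its slot. -/
def IsCached (j : Fin K) (r : Fin N) : Part K N n ⊕ Fin L → Prop
  | .inl ⟨k, W, _⟩ => ∀ h : j ≠ k, ((⟨j, h⟩, r) : Slot K N k) ∈ W
  | .inr _ => True

/-- The bits of file `i` transmitted by user `k` and cached by the slots of `W`, as a sequence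
padded with zeros. -/
def chunk (e : Fin B ≃ Part K N n ⊕ Fin L) (F : Library N B) (k : Fin K) (i : Fin N)
    (W : Finset (Slot K N k)) (l : ℕ) : ZMod 2 :=
  if h : l < n W.card then if F i (e.symm (.inl ⟨k, W, l, h⟩)) then 1 else 0 else 0

/-- The demands of the slots served by user `k`. -/
def slotDemand (m : Demands K N) (k : Fin K) (v : Slot K N k) : Fin N := v.2 + m v.1

open Classical in
/-- The delivery of coded multicast messages by each user, for the sets of slots that contain a
slot of the leading user. -/
def multicastCode (lead : ∀ k : Fin K, {j : Fin K // j ≠ k}) (e : Fin B ≃ Part K N n ⊕ Fin L) :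
    ShiftCode K N B where
  Index k := Σ S : {S : Finset (Slot K N k) // ∃ x, (lead k, x) ∈ S}, Fin (n (S.1.card - 1))
  indexFintype _ := inferInstance
  cached j r := Finset.univ.filter fun ib => IsCached j r (e ib.2)
  message k m F Sl := decide (multicast (slotDemand m k) (chunk e F k) Sl.1.1 Sl.2 = 1)

variable (lead : ∀ k : Fin K, {j : Fin K // j ≠ k}) (e : Fin B ≃ Part K N n ⊕ Fin L)

lemma mem_cached {j : Fin K} {r : Fin N} {ib : Fin N × Fin B} :
    ib ∈ (multicastCode lead e).cached j r ↔ IsCached j r (e ib.2) := by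
  classical
  exact (Finset.mem_filter.trans (and_iff_right (Finset.mem_univ _)))

/-- All parts in the message of `S` have index sets of size `|S| - 1`, hence equal length, so
nothing but padding lies beyond the transmitted bits. -/
lemma multicast_chunk_eq_zero (F : Library N B) (k : Fin K) (d : Slot K N k → Fin N)
    {S : Finset (Slot K N k)} {l : ℕ} (hl : ¬ l < n (S.card - 1)) :
    multicast d (chunk e F k) S l = 0 := by
  rw [multicast, Finset.sum_apply]
  refine Finset.sum_eq_zero fun v hv => ?_
  rw [chunk, dif_neg]
  rwa [Finset.card_erase_of_mem hv]

lemma chunk_eq {j : Fin K} {r : Fin N} {F F' : Library N B}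
    (h : ShiftCode.AgreeOn ((multicastCode lead e).cached j r) F F') {k : Fin K}
    {W : Finset (Slot K N k)} (hW : ∀ h : j ≠ k, ((⟨j, h⟩, r) : Slot K N k) ∈ W) (i : Fin N) :
    chunk e F k i W = chunk e F' k i W := by
  funext l
  unfold chunk
  by_cases hl : l < n W.card
  · have : F i (e.symm (.inl ⟨k, W, l, hl⟩)) = F' i (e.symm (.inl ⟨k, W, l, hl⟩)) := by
      refine h (i, e.symm (.inl ⟨k, W, l, hl⟩)) ((mem_cached lead e).2 ?_)
      rw [Equiv.apply_symm_apply]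
      exact hW
    rw [dif_pos hl, dif_pos hl, this]
  · rw [dif_neg hl, dif_neg hl]

lemma isLocal_multicastCode : (multicastCode lead e).IsLocal := by
  intro k r m F F' h
  have : chunk e F k = chunk e F' k :=
    funext fun i => funext fun W => chunk_eq lead e h (fun h => (h rfl).elim) i
  funext Sl
  simp only [multicastCode, this]

lemma multicast_eq_of_message_eq [NeZero N] {k : Fin K} {m : Demands K N} {F F' : Library N B}
    (h : (multicastCode lead e).message k m F = (multicastCode lead e).message k m F')
    (S : Finset (Slot K N k)) :
    multicast (slotDemand m k) (chunk e F k) S = multicast (slotDemand m k) (chunk e F' k) S := by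
  have h2 : ∀ x : ZMod 2, x + x = 0 := by decide
  have h3 : ∀ x y : ZMod 2, (x = 1 ↔ y = 1) → x = y := by decide
  refine multicast_eq_of_leaders (fun x => funext fun l => h2 (x l))
    -- The slot of `lead k` that demands file `i`.
    (u := fun i => (lead k, i - m (lead k))) (fun i => sub_add_cancel _ _) ?_ S
  rintro S ⟨i, hi⟩
  funext l
  by_cases hl : l < n (S.card - 1)
  · have := congrFun h ⟨⟨S, _, hi⟩, l, hl⟩
    simp only [multicastCode, decide_eq_decide] at this
    exact h3 _ _ this
  · rw [multicast_chunk_eq_zero e F k _ hl, multicast_chunk_eq_zero e F' k _ hl]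

/-- User `j` caches its own parts and the leftover bits; it decodes parts served by others as slot
`(j, r)`. -/
lemma isDecodable_multicastCode [NeZero N] : (multicastCode lead e).IsDecodable := by
  intro j r m F F' hc hm
  funext b
  obtain ⟨x, rfl⟩ := e.symm.surjective b
  rcases x with ⟨k, W, l⟩ | x
  · have hch : chunk e F k (r + m j) W = chunk e F' k (r + m j) W := by
      by_cases hjk : j = k
      · exact chunk_eq lead e hc (fun h => (h hjk).elim) _
      · exact eq_of_multicast_eq (d := slotDemand m k) (v := (⟨j, hjk⟩, r))
          (fun i W hW => chunk_eq lead e hc (fun _ => hW) i)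
          (multicast_eq_of_message_eq lead e (hm k)) W
    have := congrFun hch l
    simp only [chunk, l.2, dif_pos] at this
    revert this
    cases F (r + m j) (e.symm (.inl ⟨k, W, l⟩)) <;>
      cases F' (r + m j) (e.symm (.inl ⟨k, W, l⟩)) <;> simp
  · refine hc (r + m j, e.symm (.inr x)) ((mem_cached lead e).2 ?_)
    rw [Equiv.apply_symm_apply]
    trivial

end Code

/-! ### Cache size and number of message bits -/

section Counting

lemma sum_subset_apply_card {V : Type*} [Fintype V] [DecidableEq V] (Q : Finset V) (f : ℕ → ℝ) :
    ∑ W : Finset V with W ⊆ Q, f W.card =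
      ∑ s ∈ Finset.range (Fintype.card V + 1), (Q.card.choose s : ℝ) * f s := by
  rw [show (Finset.univ.filter fun W : Finset V => W ⊆ Q) = Q.powerset by ext; simp,
    Finset.sum_powerset_apply_card]
  simp_rw [nsmul_eq_mul]
  refine Finset.sum_subset (Finset.range_mono (Nat.succ_le_succ Q.card_le_univ)) fun s _ hs => ?_
  rw [Nat.choose_eq_zero_of_lt (by simpa using hs), Nat.cast_zero, zero_mul]

lemma sum_apply_card {V : Type*} [Fintype V] [DecidableEq V] (f : ℕ → ℝ) :
    ∑ W : Finset V, f W.card =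
      ∑ s ∈ Finset.range (Fintype.card V + 1), ((Fintype.card V).choose s : ℝ) * f s := by
  simpa using sum_subset_apply_card (Finset.univ : Finset V) f

lemma sum_not_subset_apply_card {V : Type*} [Fintype V] [DecidableEq V] (Q : Finset V)
    (f : ℕ → ℝ) :
    ∑ W : Finset V with ¬ W ⊆ Q, f W.card =
      ∑ s ∈ Finset.range (Fintype.card V + 1),
        (((Fintype.card V).choose s : ℝ) - Q.card.choose s) * f s := by
  have h := Finset.sum_filter_add_sum_filter_not Finset.univ (fun W : Finset V => W ⊆ Q)
    fun W => f W.card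
  rw [sum_apply_card, sum_subset_apply_card] at h
  simp_rw [sub_mul, Finset.sum_sub_distrib]
  linarith

variable {K N B L : ℕ} {n : ℕ → ℕ}

lemma card_slot (k : Fin K) : Fintype.card (Slot K N k) = (K - 1) * N := by
  simp [Fintype.card_subtype_compl]

lemma card_part : (Fintype.card (Part K N n) : ℝ) =
    ∑ s ∈ Finset.range ((K - 1) * N + 1), K * (((K - 1) * N).choose s : ℝ) * n s := by
  simp only [Fintype.card_sigma, Fintype.card_fin, Nat.cast_sum]
  rw [Finset.sum_congr rfl fun k _ => (sum_apply_card fun s => (n s : ℝ)).trans (by rw [card_slot])]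
  rw [Finset.sum_const, Finset.card_univ, Fintype.card_fin, nsmul_eq_mul, Finset.mul_sum]
  simp_rw [mul_assoc]

variable (lead : ∀ k : Fin K, {j : Fin K // j ≠ k}) (e : Fin B ≃ Part K N n ⊕ Fin L)

/-- Sets with a leader are those not inside the `U - N` slots of the other users. -/
lemma card_index (k : Fin K) : (Fintype.card ((multicastCode lead e).Index k) : ℝ) =
    ∑ s ∈ Finset.range ((K - 1) * N + 1),
      ((((K - 1) * N).choose (s + 1) : ℝ) - ((K - 1) * N - N).choose (s + 1)) * n s := by
  classical
  set U := (K - 1) * N with hU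
  set Q : Finset (Slot K N k) := Finset.univ.filter fun v => v.1 ≠ lead k
  have hQ : Q.card = U - N := by
    have h1 : Q = (Finset.univ.erase (lead k)) ×ˢ Finset.univ := by
      ext v
      simp [Q]
    rw [h1, Finset.card_product, Finset.card_erase_of_mem (Finset.mem_univ _), Finset.card_univ,
      Finset.card_univ, Fintype.card_fin, Nat.sub_mul, one_mul, hU, ← card_slot (N := N) k,
      Fintype.card_prod, Fintype.card_fin]
  have h := sum_not_subset_apply_card Q fun s => (n (s - 1) : ℝ)
  -- Set size is `s + 1`: the empty set and the term `s = U` contribute zero.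
  rw [card_slot, hQ, Finset.sum_range_succ'] at h
  have hlt : U - N < U + 1 := by omega
  rw [Finset.sum_range_succ, Nat.choose_eq_zero_of_lt (Nat.lt_succ_self U),
    Nat.choose_eq_zero_of_lt hlt]
  simp only [Nat.choose_zero_right, Nat.cast_one, sub_self, zero_mul, add_zero,
    Nat.add_sub_cancel] at h
  rw [Nat.cast_zero, sub_self, zero_mul, add_zero, ← h]
  change (Fintype.card (Σ S : {S : Finset (Slot K N k) // ∃ x, (lead k, x) ∈ S},
    Fin (n (S.1.card - 1))) : ℝ) = _
  rw [Fintype.card_sigma, Nat.cast_sum]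
  simp only [Fintype.card_fin]
  rw [← Finset.sum_subtype (p := fun S : Finset (Slot K N k) => ∃ x, (lead k, x) ∈ S)
    (Finset.univ.filter fun S => ¬ S ⊆ Q) ?_ fun S => (n (S.card - 1) : ℝ)]
  intro S
  simp only [Finset.mem_filter, Finset.mem_univ, true_and, Finset.not_subset, Q, not_not]
  constructor
  · rintro ⟨⟨j, x⟩, h1, rfl⟩
    exact ⟨x, h1⟩
  · rintro ⟨x, hx⟩
    exact ⟨_, hx, rfl⟩

/-- Of the parts with `|W| = s`, user `j` caches all `C(U, s)` it serves, and a fraction `s / U` of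
those of each of the `K - 1` others. Over `N` files this totals `C(U, s) * (N + s)`, as `U = (K - 1)
* N`. -/
lemma card_cached [NeZero N] (hK : 2 ≤ K) (j : Fin K) (r : Fin N) :
    (((multicastCode lead e).cached j r).card : ℝ) =
      ∑ s ∈ Finset.range ((K - 1) * N + 1), (((K - 1) * N).choose s : ℝ) * (N + s) * n s
        + N * L := by
  classical
  set U := (K - 1) * N with hU
  have hUr : (U : ℝ) = (K - 1) * N := by
    rw [hU, Nat.cast_mul, Nat.cast_sub (by omega), Nat.cast_one]
  have hUpos : 0 < U := Nat.mul_pos (by omega) (NeZero.pos N)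
  have h1 : (multicastCode lead e).cached j r =
      Finset.univ ×ˢ Finset.univ.filter fun b => IsCached j r (e b) := by
    ext ib
    simp [multicastCode]
  have h2 : ((Finset.univ.filter fun b => IsCached j r (e b)).card : ℝ) =
      ∑ k, ∑ W : Finset (Slot K N k),
        (if ∀ h : j ≠ k, ((⟨j, h⟩, r) : Slot K N k) ∈ W then (n W.card : ℝ) else 0) + L := by
    rw [Finset.card_filter, Nat.cast_sum,
      Equiv.sum_comp e fun x => ((if IsCached j r x then 1 else 0 : ℕ) : ℝ),
      Fintype.sum_sum_type, Fintype.sum_sigma]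
    congr 1
    · refine Finset.sum_congr rfl fun k _ => ?_
      rw [Fintype.sum_sigma]
      refine Finset.sum_congr rfl fun W _ => ?_
      by_cases hW : ∀ h : j ≠ k, ((⟨j, h⟩, r) : Slot K N k) ∈ W
      · have hl : ∀ l, IsCached j r (.inl ⟨k, W, l⟩ : Part K N n ⊕ Fin L) := fun _ => hW
        rw [if_pos hW, Finset.sum_congr rfl fun l _ => congrArg Nat.cast (if_pos (hl l))]
        simp
      · have hl : ∀ l, ¬ IsCached j r (.inl ⟨k, W, l⟩ : Part K N n ⊕ Fin L) := fun _ => hW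
        rw [if_neg hW, Finset.sum_congr rfl fun l _ => congrArg Nat.cast (if_neg (hl l))]
        simp
    · simp [IsCached]
  have hself : ∑ W : Finset (Slot K N j),
      (if ∀ h : j ≠ j, ((⟨j, h⟩, r) : Slot K N j) ∈ W then (n W.card : ℝ) else 0) =
      ∑ s ∈ Finset.range (U + 1), (U.choose s : ℝ) * n s := by
    rw [hU, ← card_slot (N := N) j, ← sum_apply_card fun s => (n s : ℝ)]
    exact Finset.sum_congr rfl fun W _ => if_pos fun h => (h rfl).elim
  have hother : ∀ k ∈ Finset.univ.erase j, ∑ W : Finset (Slot K N k),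
      (if ∀ h : j ≠ k, ((⟨j, h⟩, r) : Slot K N k) ∈ W then (n W.card : ℝ) else 0) =
      ∑ s ∈ Finset.range (U + 1), ((U.choose s : ℝ) - (U - 1).choose s) * n s := by
    intro k hk
    have hjk : j ≠ k := (Finset.ne_of_mem_erase hk).symm
    have hc : (Finset.univ.erase ((⟨j, hjk⟩, r) : Slot K N k)).card = U - 1 := by
      rw [Finset.card_erase_of_mem (Finset.mem_univ _), Finset.card_univ, card_slot]
    have h := sum_not_subset_apply_card (Finset.univ.erase ((⟨j, hjk⟩, r) : Slot K N k))
      fun s => (n s : ℝ)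
    rw [hc, card_slot, Finset.sum_filter] at h
    rw [← h]
    refine Finset.sum_congr rfl fun W _ => if_congr ?_ rfl rfl
    rw [Finset.subset_erase]
    simp [hjk]
  have hK1 : ((K - 1 : ℕ) : ℝ) = K - 1 := by rw [Nat.cast_sub (by omega), Nat.cast_one]
  rw [h1, Finset.card_product, Finset.card_univ, Fintype.card_fin, Nat.cast_mul, h2, mul_add,
    ← Finset.add_sum_erase _ _ (Finset.mem_univ j), hself, Finset.sum_congr rfl hother,
    Finset.sum_const, Finset.card_erase_of_mem (Finset.mem_univ j), Finset.card_univ,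
    Fintype.card_fin, nsmul_eq_mul, hK1, Finset.mul_sum, ← Finset.sum_add_distrib, Finset.mul_sum]
  congr 1
  refine Finset.sum_congr rfl fun s hs => ?_
  have hs : s ≤ U := Nat.lt_succ_iff.1 (Finset.mem_range.1 hs)
  have hch : ((U - 1).choose s : ℝ) * U = U.choose s * (U - s) := by
    have := Nat.choose_mul_succ_eq (U - 1) s
    rw [Nat.sub_add_cancel hUpos] at this
    rw [← Nat.cast_sub hs]
    exact_mod_cast this
  have : (N : ℝ) * ((K - 1) * (U - 1).choose s) = U.choose s * ((K - 1) * N - s) := by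
    rw [← hUr, ← hch, hUr]
    ring
  linear_combination (-(n s : ℝ)) * this

end Counting

/-! ### Memory sharing and the convex hull -/

section Achievability

/-- Memory sharing: every convex combination of the points of the multicast codes is
achievable. -/
lemma achievable_convex_combination {K N : ℕ} (hK : 2 ≤ K) (hN : 0 < N) (w : ℕ → ℝ)
    (hw : ∀ s ∈ Finset.range ((K - 1) * N + 1), 0 ≤ w s)
    (hw1 : ∑ s ∈ Finset.range ((K - 1) * N + 1), w s = 1) :
    Achievable K N
      (∑ s ∈ Finset.range ((K - 1) * N + 1), w s * ((N + s) / K))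
      (∑ s ∈ Finset.range ((K - 1) * N + 1), w s *
        (((((K - 1) * N).choose (s + 1) : ℝ) - (((K - 1) * N - N).choose (s + 1) : ℝ)) /
          (((K - 1) * N).choose s : ℝ))) := by
  have : NeZero N := ⟨hN.ne'⟩
  have : Nontrivial (Fin K) := Fin.nontrivial_iff_two_le.2 hK
  set U := (K - 1) * N with hU
  have hKpos : (0 : ℝ) < K := by exact_mod_cast (by omega : 0 < K)
  have hchoose : ∀ s ∈ Finset.range (U + 1), (0 : ℝ) < U.choose s := fun s hs => by
    exact_mod_cast Nat.choose_pos (Nat.lt_succ_iff.1 (Finset.mem_range.1 hs))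
  -- Rounding down loses at most one bit for each of the `K * C(U, s)` parts of each file.
  set c : ℝ := N * ∑ s ∈ Finset.range (U + 1), K * (U.choose s : ℝ)
  have hc : 0 ≤ c := by positivity
  set c' : ℝ := c + (K * K + 1) * Real.logb 2 N
  have hc' : 0 ≤ c' := by
    have : 0 ≤ Real.logb 2 N := Real.logb_nonneg (by norm_num) (by exact_mod_cast hN)
    positivity
  refine ⟨fun B => c' / B, fun B => by positivity, tendsto_const_div_atTop_nhds_zero_nat c', ?_⟩
  filter_upwards [Filter.eventually_gt_atTop 0] with B hB
  have hB : (0 : ℝ) < B := by exact_mod_cast hB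
  -- A share `w s` of each file is cut into `K * C(U, s)` equal parts.
  set n : ℕ → ℕ := fun s => ⌊w s * B / (K * U.choose s)⌋₊
  have hle : ∀ s ∈ Finset.range (U + 1), K * (U.choose s : ℝ) * n s ≤ w s * B := by
    intro s hs
    have h1 := hchoose s hs
    have := Nat.floor_le (a := w s * B / (K * U.choose s))
      (div_nonneg (mul_nonneg (hw s hs) hB.le) (by positivity))
    rw [le_div_iff₀ (by positivity)] at this
    linarith
  have hge : ∀ s ∈ Finset.range (U + 1),
      w s * B ≤ K * (U.choose s : ℝ) * n s + K * U.choose s := by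
    intro s hs
    have h1 := hchoose s hs
    have := (Nat.lt_floor_add_one (w s * B / (K * U.choose s))).le
    rw [div_le_iff₀ (by positivity)] at this
    linarith
  have hpart : (Fintype.card (Part K N n) : ℝ) ≤ B := by
    rw [card_part]
    refine (Finset.sum_le_sum hle).trans ?_
    rw [← Finset.sum_mul, hw1, one_mul]
  have hpart' : Fintype.card (Part K N n) ≤ B := by exact_mod_cast hpart
  -- Leftover bits of each file, cached by everyone.
  set L := B - Fintype.card (Part K N n) with hL
  have hLc : N * (L : ℝ) ≤ c := by
    refine mul_le_mul_of_nonneg_left ?_ (by positivity)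
    rw [hL, Nat.cast_sub hpart', card_part, sub_le_iff_le_add', ← Finset.sum_add_distrib]
    refine le_trans (le_of_eq ?_) (Finset.sum_le_sum hge)
    rw [← Finset.sum_mul, hw1, one_mul]
  have e : Fin B ≃ Part K N n ⊕ Fin L := Fintype.equivOfCardEq (by
    rw [Fintype.card_sum, Fintype.card_fin, Fintype.card_fin]
    omega)
  choose lead hlead using fun k : Fin K => exists_ne k
  refine ⟨(multicastCode (fun k => ⟨lead k, hlead k⟩) e).toScheme, ShiftCode.isUncoded_toScheme _,
    ShiftCode.meets_toScheme (isLocal_multicastCode _ e) (isDecodable_multicastCode _ e) hc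
      (fun j r => ?_) ?_ ?_⟩
  · rw [card_cached _ e hK]
    refine add_le_add ?_ hLc
    rw [Finset.mul_sum]
    refine Finset.sum_le_sum fun s hs => ?_
    calc (U.choose s : ℝ) * (N + s) * n s = (K * (U.choose s : ℝ) * n s) * ((N + s) / K) := by
          field_simp
      _ ≤ (w s * B) * ((N + s) / K) := mul_le_mul_of_nonneg_right (hle s hs) (by positivity)
      _ = B * (w s * ((N + s) / K)) := by ring
  · simp_rw [card_index _ e]
    rw [Finset.sum_const, Finset.card_univ, Fintype.card_fin, nsmul_eq_mul, Finset.mul_sum,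
      Finset.mul_sum]
    refine Finset.sum_le_sum fun s hs => ?_
    have h1 := hchoose s hs
    have h2 : 0 ≤ (U.choose (s + 1) : ℝ) - (U - N).choose (s + 1) :=
      sub_nonneg.2 (by exact_mod_cast Nat.choose_le_choose _ (Nat.sub_le U N))
    set x : ℝ := (U.choose (s + 1) : ℝ) - (U - N).choose (s + 1)
    calc (K : ℝ) * (x * n s) = (K * (U.choose s : ℝ) * n s) * (x / U.choose s) := by
          field_simp
      _ ≤ (w s * B) * (x / U.choose s) := mul_le_mul_of_nonneg_right (hle s hs) (by positivity)
      _ = B * (w s * (x / U.choose s)) := by ring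
  · rw [mul_div_cancel₀ _ hB.ne']

lemma achievable_of_mem_convexHull {K N : ℕ} (hK : 2 ≤ K) (hN : 0 < N) {M R : ℝ}
    (h : (M, R) ∈ convexHull ℝ (schemeAPoints K N)) : Achievable K N M R := by
  classical
  set U := (K - 1) * N with hU
  set pt : ℕ → ℝ × ℝ := fun s => (((N : ℝ) + s) / K,
    ((U.choose (s + 1) : ℝ) - ((U - N).choose (s + 1) : ℝ)) / (U.choose s : ℝ))
  have hKpos : (K : ℝ) ≠ 0 := by exact_mod_cast (by omega : K ≠ 0)
  have hpt : schemeAPoints K N = ((Finset.range (U + 1)).image pt : Finset (ℝ × ℝ)) := by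
    ext P
    simp only [schemeAPoints, Set.mem_ofPred_eq, Finset.coe_image, Set.mem_image, Finset.coe_range,
      Set.mem_Iio]
    constructor
    · rintro ⟨t, ht1, ht, rfl⟩
      obtain ⟨s, rfl⟩ := Nat.exists_eq_add_of_le' ht1
      refine ⟨s, by omega, ?_⟩
      simp only [pt, Nat.add_sub_cancel, Nat.cast_add, Nat.cast_one]
      rw [← add_assoc, add_sub_cancel_right]
    · rintro ⟨s, hs, rfl⟩
      refine ⟨s + 1, by omega, by omega, ?_⟩
      simp only [pt, Nat.add_sub_cancel, Nat.cast_add, Nat.cast_one]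
      rw [← add_assoc, add_sub_cancel_right]
  -- Distinct abscissas let weights on points become weights on `s`.
  have hinj : Set.InjOn pt (Finset.range (U + 1)) := by
    intro s _ s' _ hss
    have := (Prod.mk.inj hss).1
    rw [div_left_inj' hKpos] at this
    exact_mod_cast add_left_cancel this
  rw [hpt, Finset.mem_convexHull'] at h
  obtain ⟨w, hw, hw1, hwx⟩ := h
  rw [Finset.sum_image hinj] at hw1 hwx
  have hM := congrArg Prod.fst hwx
  have hR := congrArg Prod.snd hwx
  rw [Prod.fst_sum] at hM
  rw [Prod.snd_sum] at hR
  have := achievable_convex_combination hK hN (fun s => w (pt s))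
    (fun s hs => hw _ (Finset.mem_image_of_mem _ hs)) hw1
  dsimp only at hM hR
  rw [← hM, ← hR]
  exact this

end Achievability

end D2DCaching
end

theorem theorem1 (K N : ℕ) (hK : 2 ≤ K) (hN : 2 ≤ N) (M : ℝ)
    (hM : M ∈ Set.Icc ((N : ℝ) / K) (N : ℝ)) :
    D2DCaching.optimalLoad K N M ≤
      D2DCaching.lowerConvexEnvelope (D2DCaching.schemeAPoints K N) M := by
  refine le_sInf ?_
  rintro _ ⟨R, hR, rfl⟩
  exact sInf_le ⟨R, D2DCaching.achievable_of_mem_convexHull hK (by omega) hR, rfl⟩
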